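/- Let $\mathsf{Prop}$ be a countable set of letters and $I$ a set of agents. Boolean formulas are $P ::= p \mid \lnot P \mid (P\land P)$ with $p\in\mathsf{Prop}$, and the full language $\mathcal L$ is $\phi ::= P \mid P\equiv P \mid \lnot\phi \mid (\phi\land\phi)\mid \Box_i\phi\mid[\phi]\phi$ with $i\in I$; put $\phi\lor\psi:=\lnot(\lnot\phi\land\lnot\psi)$, $\phi\to\psi:=\lnot\phi\lor\psi$, $\phi\leftrightarrow\psi:=(\phi\to\psi)\land(\psi\to\phi)$. A model consists of a nonempty set $W$ of worlds, a relation $R_i\subseteq W\times W$ for each $i\in I$, and for each world $w$ a valuation $V_w:\mathsf{Prop}\to\{0,1\}$, extended to boolean formulas as usual, and a definition function $\mathsf{DEF}_w$ from $\mathsf{Prop}$ to boolean formulas, extended to a map $\mathsf{def}_w$ on boolean formulas that commutes with $\lnot$ and $\land$, such that for all $w$: (a) $\mathsf{def}_w(P)=\mathsf{def}_w(Q)$ implies $V_w(P)=V_w(Q)$ for all boolean $P,Q$; (b) if $p$ occurs in $\mathsf{DEF}_w(q)$, then $\mathsf{DEF}_w(p)=p$. Truth at a world is defined as usual for letters, $\lnot$,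 $\land$ and $\Box_i$ (quantifying over $R_i$-successors); $P\equiv Q$ is true at $w$ iff $\mathsf{def}_w(P)$ and $\mathsf{def}_w(Q)$ are syntactically equal; and $[\phi]\psi$ is true at $w$ iff, if $\phi$ is true at $w$, then $\psi$ is true at $w$ in the restriction of the model to the worlds where $\phi$ is true. A formula is valid if it is true at every world of every model. The proof system $\mathbb{SMLD}$ has the rules modus ponens and necessitation (from $\phi$ infer $\Box_i\phi$), and the axiom schemes: all propositional tautologies; $\Box_i(\phi\to\psi)\to(\Box_i\phi\to\Box_i\psi)$; $P\equiv P$; $(P\equiv Q)\to(Q\equiv P)$; $((P\equiv Q)\land(Q\equiv R))\to(P\equiv R)$; $(P\equiv Q)\to(P\leftrightarrow Q)$; $((p\equiv Q)\land(R\equiv S))\to(R\equiv S')$, where $S'$ is $S$ with the $k$-th occurrence of the letter $p$ replaced by $Q$; $(\lnot P\equiv\lnot Q)\leftrightarrow(P\equiv Q)$; $((P\land Q)\equiv(R\land S))\leftrightarrow((P\equiv R)\land(Q\equiv S))$; $\lnot(\lnot P\equiv(Q\land R))$; and $\lnot(p\equiv P)$ whenever the letter $p$ occurs in $P$ and $P\neq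 p$. The system $\mathbb{SPALD}$ has in addition the schemes $[\phi]p\leftrightarrow(\phi\to p)$; $[\phi](P\equiv Q)\leftrightarrow(\phi\to(P\equiv Q))$; $[\phi]\lnot\psi\leftrightarrow(\phi\to\lnot[\phi]\psi)$; $[\phi](\psi\land\theta)\leftrightarrow([\phi]\psi\land[\phi]\theta)$; $[\phi]\Box_i\psi\leftrightarrow(\phi\to\Box_i(\phi\to[\phi]\psi))$; $[\phi][\psi]\xi\leftrightarrow[\phi\land[\phi]\psi]\xi$. Theorem (Completeness). $\mathbb{SMLD}$ is weakly complete for the announcement-free fragment of $\mathcal L$: every valid formula without announcement operators is provable in $\mathbb{SMLD}$. $\mathbb{SPALD}$ is weakly complete for the full language $\mathcal L$: every valid formula of $\mathcal L$ is provable in $\mathbb{SPALD}$. -/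

import Mathlib

universe u v w

namespace PALD

/-- The boolean language: letters, negation, conjunction.  As an inductive type it keeps track of
all parentheses, so equality of `BForm` is syntactic equality. -/
inductive BForm (Atom : Type u) : Type u where
  | atom : Atom → BForm Atom
  | neg : BForm Atom → BForm Atom
  | and : BForm Atom → BForm Atom → BForm Atom

/-- The full language.  Boolean formulas are included through `BForm.toFormula`, which identifies
the boolean connectives with those of the full language. -/
inductive Formula (Atom : Type u) (Agent : Type v) : Type (max u v) where
  | atom : Atom → Formula Atom Agent
  | equiv : BForm Atom → BForm Atom → Formula Atom Agent
  | neg : Formula Atom Agent → Formula Atom Agent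
  | and : Formula Atom Agent → Formula Atom Agent → Formula Atom Agent
  | box : Agent → Formula Atom Agent → Formula Atom Agent
  | ann : Formula Atom Agent → Formula Atom Agent → Formula Atom Agent

namespace BForm

variable {Atom : Type u}

def toFormula {Agent : Type v} : BForm Atom → Formula Atom Agent
  | atom p => .atom p
  | neg P => .neg P.toFormula
  | and P Q => .and P.toFormula Q.toFormula

/-- The letter `p` occurs in a boolean formula. -/
def Occurs (p : Atom) : BForm Atom → Prop
  | atom q => p = q
  | neg P => Occurs p P
  | and P Q => Occurs p P ∨ Occurs p Q

/-- Truth value of a boolean formula under a valuation of the letters. -/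
def eval (V : Atom → Bool) : BForm Atom → Bool
  | atom p => V p
  | neg P => !(eval V P)
  | and P Q => eval V P && eval V Q

/-- The lifting of a definition function from letters to boolean formulas. -/
def unravel (D : Atom → BForm Atom) : BForm Atom → BForm Atom
  | atom p => D p
  | neg P => neg (unravel D P)
  | and P Q => and (unravel D P) (unravel D Q)

/-- The number of occurrences of the letter `p`. -/
def count [DecidableEq Atom] (p : Atom) : BForm Atom → ℕ
  | atom q => if q = p then 1 else 0
  | neg P => count p P
  | and P Q => count p P + count p Q

/-- `occSubst p Q k S` replaces the `k`-th occurrence of `p` in `S` by `Q`, where occurrences are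
numbered `1, 2, …, count p S` from left to right. -/
def occSubst [DecidableEq Atom] (p : Atom) (Q : BForm Atom) : ℕ → BForm Atom → BForm Atom
  | k, atom q => if q = p ∧ k = 1 then Q else atom q
  | k, neg S => neg (occSubst p Q k S)
  | k, and S T =>
      if k ≤ count p S then and (occSubst p Q k S) T
      else and S (occSubst p Q (k - count p S) T)

end BForm

namespace Formula

variable {Atom : Type u} {Agent : Type v}

def or (φ ψ : Formula Atom Agent) : Formula Atom Agent := neg (and (neg φ) (neg ψ))

def imp (φ ψ : Formula Atom Agent) : Formula Atom Agent := or (neg φ) ψ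

def iff (φ ψ : Formula Atom Agent) : Formula Atom Agent := and (imp φ ψ) (imp ψ φ)

/-- The formula contains no announcement operator. -/
def AnnFree : Formula Atom Agent → Prop
  | atom _ => True
  | equiv _ _ => True
  | neg φ => AnnFree φ
  | and φ ψ => AnnFree φ ∧ AnnFree ψ
  | box _ φ => AnnFree φ
  | ann _ _ => False

/-- Boolean evaluation in which every formula that is not a negation or a conjunction is treated
as a propositional variable whose value is given by `e`. -/
def propEval (e : Formula Atom Agent → Bool) : Formula Atom Agent → Bool
  | neg φ => !(propEval e φ)
  | and φ ψ => propEval e φ && propEval e ψ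
  | atom p => e (atom p)
  | equiv P Q => e (equiv P Q)
  | box i φ => e (box i φ)
  | ann φ ψ => e (ann φ ψ)

/-- (Substitution instances of) propositional tautologies. -/
def Tautology (φ : Formula Atom Agent) : Prop :=
  ∀ e : Formula Atom Agent → Bool, propEval e φ = true

end Formula

/-! ### Models and semantics -/

structure Premodel (Atom : Type u) (Agent : Type v) : Type (max u v (w + 1)) where
  World : Type w
  nonempty : Nonempty World
  R : Agent → World → World → Prop
  V : World → Atom → Bool
  DEF : World → Atom → BForm Atom

structure Model (Atom : Type u) (Agent : Type v) : Type (max u v (w + 1))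
    extends Premodel.{u, v, w} Atom Agent where
  eval_eq : ∀ (x : World) (P Q : BForm Atom),
    P.unravel (DEF x) = Q.unravel (DEF x) → P.eval (V x) = Q.eval (V x)
  selfEvident : ∀ (x : World) (p q : Atom), (DEF x q).Occurs p → DEF x p = .atom p

section

variable {Atom : Type u} {Agent : Type v}

/-- Restriction of a model to a nonempty set of worlds. -/
def Model.restrict (M : Model.{u, v, w} Atom Agent) (S : Set M.World) (hS : S.Nonempty) :
    Model.{u, v, w} Atom Agent where
  World := S
  nonempty := hS.to_subtype
  R := fun i x y => M.R i x y
  V := fun x => M.V x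
  DEF := fun x => M.DEF x
  eval_eq := fun x => M.eval_eq x
  selfEvident := fun x => M.selfEvident x

/-- Truth of a formula at a world of a model. -/
def Sat : Formula Atom Agent → (M : Model.{u, v, w} Atom Agent) → M.World → Prop
  | .atom p, M, x => M.V x p = true
  | .equiv P Q, M, x => P.unravel (M.DEF x) = Q.unravel (M.DEF x)
  | .neg φ, M, x => ¬ Sat φ M x
  | .and φ ψ, M, x => Sat φ M x ∧ Sat ψ M x
  | .box i φ, M, x => ∀ y, M.R i x y → Sat φ M y
  | .ann φ ψ, M, x =>
      ∀ h : Sat φ M x, Sat ψ (M.restrict {y | Sat φ M y} ⟨x, h⟩) ⟨x, h⟩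

/-- Truth at every world of every model (with worlds in the universe `w`). -/
def Valid (φ : Formula Atom Agent) : Prop :=
  ∀ (M : Model.{u, v, w} Atom Agent) (x : M.World), Sat φ M x

/-! ### The proof systems -/

/-- The schemes of the system without announcements: tautologies, `K`, and the definition
schemes. -/
inductive MLDScheme [DecidableEq Atom] : Formula Atom Agent → Prop where
  | taut (φ : Formula Atom Agent) (h : φ.Tautology) : MLDScheme φ
  | distK (i : Agent) (φ ψ : Formula Atom Agent) :
      MLDScheme (.imp (.box i (.imp φ ψ)) (.imp (.box i φ) (.box i ψ)))
  | refl (P : BForm Atom) : MLDScheme (.equiv P P)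
  | symm (P Q : BForm Atom) : MLDScheme (.imp (.equiv P Q) (.equiv Q P))
  | trans (P Q R : BForm Atom) :
      MLDScheme (.imp (.and (.equiv P Q) (.equiv Q R)) (.equiv P R))
  | equivalence (P Q : BForm Atom) :
      MLDScheme (.imp (.equiv P Q) (.iff P.toFormula Q.toFormula))
  | occurrence (p : Atom) (Q R S : BForm Atom) (k : ℕ) (hk : 1 ≤ k) (hk' : k ≤ S.count p) :
      MLDScheme (.imp (.and (.equiv (.atom p) Q) (.equiv R S)) (.equiv R (BForm.occSubst p Q k S)))
  | patternNeg (P Q : BForm Atom) :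
      MLDScheme (.iff (.equiv (.neg P) (.neg Q)) (.equiv P Q))
  | patternAnd (P Q R S : BForm Atom) :
      MLDScheme (.iff (.equiv (.and P Q) (.and R S)) (.and (.equiv P R) (.equiv Q S)))
  | mismatch (P Q R : BForm Atom) : MLDScheme (.neg (.equiv (.neg P) (.and Q R)))
  | noncircular (p : Atom) (P : BForm Atom) (h : P.Occurs p) (h' : P ≠ .atom p) :
      MLDScheme (.neg (.equiv (.atom p) P))

/-- The reduction schemes for announcements. -/
inductive ReductionScheme : Formula Atom Agent → Prop where
  | atom (φ : Formula Atom Agent) (p : Atom) :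
      ReductionScheme (.iff (.ann φ (.atom p)) (.imp φ (.atom p)))
  | equiv (φ : Formula Atom Agent) (P Q : BForm Atom) :
      ReductionScheme (.iff (.ann φ (.equiv P Q)) (.imp φ (.equiv P Q)))
  | neg (φ ψ : Formula Atom Agent) :
      ReductionScheme (.iff (.ann φ (.neg ψ)) (.imp φ (.neg (.ann φ ψ))))
  | and (φ ψ θ : Formula Atom Agent) :
      ReductionScheme (.iff (.ann φ (.and ψ θ)) (.and (.ann φ ψ) (.ann φ θ)))
  | box (φ : Formula Atom Agent) (i : Agent) (ψ : Formula Atom Agent) :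
      ReductionScheme (.iff (.ann φ (.box i ψ)) (.imp φ (.box i (.imp φ (.ann φ ψ)))))
  | comp (φ ψ ξ : Formula Atom Agent) :
      ReductionScheme (.iff (.ann φ (.ann ψ ξ)) (.ann (.and φ (.ann φ ψ)) ξ))

/-- Derivability from a set of schemes by modus ponens and necessitation for the boxes. -/
inductive Derivable (Sch : Formula Atom Agent → Prop) : Formula Atom Agent → Prop where
  | scheme (φ : Formula Atom Agent) (h : Sch φ) : Derivable Sch φ
  | mp (φ ψ : Formula Atom Agent) (h₁ : Derivable Sch φ) (h₂ : Derivable Sch (.imp φ ψ)) :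
      Derivable Sch ψ
  | nec (i : Agent) (φ : Formula Atom Agent) (h : Derivable Sch φ) : Derivable Sch (.box i φ)

/-- Provability in SMLD. -/
def SMLD [DecidableEq Atom] (φ : Formula Atom Agent) : Prop :=
  Derivable MLDScheme φ

/-- Provability in SPALD. -/
def SPALD [DecidableEq Atom] (φ : Formula Atom Agent) : Prop :=
  Derivable (fun χ => MLDScheme χ ∨ ReductionScheme χ) φ

end

end PALD

/-! Completeness without announcements comes from a canonical model of maximal consistent sets,
built for the finite set `A` of letters of the given formula. The new task is to find, at each such
set `Γ`, a definition function that realizes the relation `P ≡ Q ∈ Γ` on formulas over `A`. The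
schemes make this relation a congruence that respects shape and has no cycles, so expanding defined
letters terminates on `A`, and every formula over `A` has exactly one normal form: all its letters
are undefined and are chosen representatives of their class (`exists_normal`, `eq_of_normal`).
Sending each letter to its normal form gives the definition function (`exists_definition`).
Finiteness of `A` is essential: the set of all `pₙ ≡ ¬pₙ₊₁` is finitely satisfiable, yet no
definition function satisfies all of it. The completeness obtained is accordingly weak. For the full
language, the reduction schemes turn each formula into an announcement-free one that is both
provably and semantically equivalent (`reducible`), and the first part applies. -/

namespace PALD

/-! ### Definitional relations and their normal forms. -/

namespace BForm

variable {Atom : Type u}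

theorem occurs_unravel {D : Atom → BForm Atom} {p : Atom} {P : BForm Atom} :
    (P.unravel D).Occurs p ↔ ∃ q, P.Occurs q ∧ (D q).Occurs p := by
  induction P with
  | atom q => simp [unravel, Occurs]
  | neg P ih => simpa [unravel, Occurs] using ih
  | and P Q ihP ihQ => simp [unravel, Occurs, ihP, ihQ, or_and_right, exists_or]

/-- The abstract properties of the relation `P ≡ Q` at a world. -/
structure IsDefinitional (r : BForm Atom → BForm Atom → Prop) : Prop where
  equivalence : Equivalence r
  neg_iff : ∀ P Q, r (neg P) (neg Q) ↔ r P Q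
  and_iff : ∀ P Q R S, r (and P Q) (and R S) ↔ r P R ∧ r Q S
  mismatch : ∀ P Q R, ¬ r (neg P) (and Q R)
  noncircular : ∀ p P, Occurs p P → P ≠ atom p → ¬ r (atom p) P

/-- All letters of the formula belong to `A`. -/
def Over (A : Set Atom) (P : BForm Atom) : Prop := ∀ p, P.Occurs p → p ∈ A

/-- The letter `p` is not definable by a compound formula over `A`. -/
def Undefined (r : BForm Atom → BForm Atom → Prop) (A : Set Atom) (p : Atom) : Prop :=
  ∀ P : BForm Atom, P.Over A → r (atom p) P → ∃ q, P = atom q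

/-- A chosen letter in `A` related to `p`. -/
noncomputable def rep (r : BForm Atom → BForm Atom → Prop) (A : Set Atom) (p : Atom) : Atom :=
  @Classical.epsilon _ ⟨p⟩ fun q => q ∈ A ∧ r (atom p) (atom q)

/-- All letters of the formula are undefined representatives. -/
def Normal (r : BForm Atom → BForm Atom → Prop) (A : Set Atom) (P : BForm Atom) : Prop :=
  ∀ p, P.Occurs p → p ∈ A ∧ Undefined r A p ∧ rep r A p = p

namespace IsDefinitional

variable {r : BForm Atom → BForm Atom → Prop} {A : Set Atom}

theorem rel_unravel (h : IsDefinitional r) {D : Atom → BForm Atom} {P : BForm Atom}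
    (hD : ∀ p, P.Occurs p → r (atom p) (D p)) : r P (P.unravel D) := by
  induction P with
  | atom p => exact hD p rfl
  | neg P ih => exact (h.neg_iff _ _).2 (ih hD)
  | and P Q ihP ihQ =>
    exact (h.and_iff _ _ _ _).2
      ⟨ihP fun p hp => hD p (Or.inl hp), ihQ fun p hp => hD p (Or.inr hp)⟩

theorem rep_spec (h : IsDefinitional r) {p : Atom} (hp : p ∈ A) :
    rep r A p ∈ A ∧ r (atom p) (atom (rep r A p)) :=
  Classical.epsilon_spec (p := fun q => q ∈ A ∧ r (atom p) (atom q))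
    ⟨p, hp, h.equivalence.refl _⟩

theorem rep_congr (h : IsDefinitional r) {p q : Atom} (hpq : r (atom p) (atom q)) :
    rep r A p = rep r A q := by
  have : (fun s => s ∈ A ∧ r (atom p) (atom s)) = fun s => s ∈ A ∧ r (atom q) (atom s) := by
    funext s
    exact propext (and_congr_right fun _ =>
      ⟨h.equivalence.trans (h.equivalence.symm hpq), h.equivalence.trans hpq⟩)
  unfold rep
  rw [this]

/-- The letter `q` occurs in a compound formula over `A` that defines the letter `p`. -/
def Below (r : BForm Atom → BForm Atom → Prop) (A : Set Atom) (q p : A) : Prop :=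
  ∃ P : BForm Atom, P.Over A ∧ r (atom p) P ∧ (∀ s, P ≠ atom s) ∧ P.Occurs (q : Atom)

/-- Irreflexivity is noncircularity. Transitivity holds because a definition of `q` can be
substituted for `q` inside a definition of `p`. A transitive irreflexive relation on a finite type
is well-founded. -/
theorem wellFounded_below (h : IsDefinitional r) (hA : A.Finite) : WellFounded (Below r A) := by
  classical
  have : Finite A := hA
  have : Std.Irrefl (Below r A) := ⟨fun p ⟨P, _, hr, hP, hp⟩ => h.noncircular _ _ hp (hP _) hr⟩
  have : IsTrans A (Below r A) := ⟨by
    rintro s q p ⟨Q, hQA, hqQ, hQ, hs⟩ ⟨P, hPA, hpP, hP, hq⟩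
    have key : r P (P.unravel fun t => if t = q then Q else atom t) := by
      refine h.rel_unravel fun t _ => ?_
      by_cases ht : t = q
      · simpa [ht] using hqQ
      · simpa [ht] using h.equivalence.refl _
    refine ⟨_, ?_, h.equivalence.trans hpP key, ?_, occurs_unravel.2 ⟨q, hq, by simpa using hs⟩⟩
    · intro t ht
      obtain ⟨a, ha, hta⟩ := occurs_unravel.1 ht
      by_cases haq : a = q
      · exact hQA t (by simpa [haq] using hta)
      · have : t = a := by simpa [haq, Occurs] using hta
        exact this ▸ hPA a ha
    -- Substitution for letters keeps the outermost connective, so the new definition is still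
    -- compound.
    · intro t
      cases P with
      | atom a => exact absurd rfl (hP a)
      | neg P => simp [unravel]
      | and P Q => simp [unravel]⟩
  exact Finite.wellFounded_of_trans_of_irrefl _

/-- Well-founded induction along `Below`: an undefined letter is replaced by its representative;
otherwise a compound definition is taken and each of its letters, being below `p`, is replaced by a
normal form. -/
theorem exists_normal (h : IsDefinitional r) (hA : A.Finite) (p : A) :
    ∃ N : BForm Atom, Normal r A N ∧ r (atom p) N := by
  induction p using (h.wellFounded_below hA).induction with
  | _ p ih =>
  by_cases hp : Undefined r A p
  · obtain ⟨hpA, hpr⟩ := h.rep_spec p.2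
    refine ⟨atom (rep r A p), ?_, hpr⟩
    rintro q rfl
    -- Being undefined depends only on the class of the letter, so it passes from `p` to its
    -- representative.
    exact ⟨hpA, fun P hP hr => hp P hP (h.equivalence.trans hpr hr), (h.rep_congr hpr).symm⟩
  · simp only [Undefined, not_forall, not_exists] at hp
    obtain ⟨P, hPA, hpP, hP⟩ := hp
    have : ∀ q : Atom, ∃ N : BForm Atom, P.Occurs q → Normal r A N ∧ r (atom q) N := by
      intro q
      by_cases hq : P.Occurs q
      · obtain ⟨N, hN⟩ := ih ⟨q, hPA q hq⟩ ⟨P, hPA, hpP, hP, hq⟩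
        exact ⟨N, fun _ => hN⟩
      · exact ⟨atom q, fun h => absurd h hq⟩
    choose D hD using this
    refine ⟨P.unravel D, ?_, h.equivalence.trans hpP (h.rel_unravel fun q hq => (hD q hq).2)⟩
    intro s hs
    obtain ⟨q, hq, hsq⟩ := occurs_unravel.1 hs
    exact (hD q hq).1 s hsq

theorem Normal.over {N : BForm Atom} (hN : Normal r A N) : N.Over A := fun p hp => (hN p hp).1

/-- Compare outermost shapes. Letter against compound is excluded because normal letters are
undefined, negation against conjunction by mismatch; related letters share their representative, and
equal shapes decompose. -/
theorem eq_of_normal (h : IsDefinitional r) {N N' : BForm Atom} (hN : Normal r A N)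
    (hN' : Normal r A N') (hr : r N N') : N = N' := by
  induction N generalizing N' with
  | atom p =>
    obtain ⟨q, rfl⟩ := (hN p rfl).2.1 N' (Normal.over hN') hr
    rw [← (hN p rfl).2.2, ← (hN' q rfl).2.2, h.rep_congr hr]
  | neg P ih =>
    cases N' with
    | atom q =>
      obtain ⟨s, hs⟩ := (hN' q rfl).2.1 _ (Normal.over hN) (h.equivalence.symm hr)
      cases hs
    | neg Q => exact congrArg BForm.neg (ih hN hN' ((h.neg_iff _ _).1 hr))
    | and Q S => exact absurd hr (h.mismatch _ _ _)
  | and P Q ihP ihQ =>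
    cases N' with
    | atom q =>
      obtain ⟨s, hs⟩ := (hN' q rfl).2.1 _ (Normal.over hN) (h.equivalence.symm hr)
      cases hs
    | neg S => exact absurd (h.equivalence.symm hr) (h.mismatch _ _ _)
    | and S T =>
      obtain ⟨h₁, h₂⟩ := (h.and_iff _ _ _ _).1 hr
      rw [ihP (fun p hp => hN p (Or.inl hp)) (fun p hp => hN' p (Or.inl hp)) h₁,
        ihQ (fun p hp => hN p (Or.inr hp)) (fun p hp => hN' p (Or.inr hp)) h₂]

/-- A definitional relation is induced by a definition function, as far as formulas over a given
finite set of letters are concerned. -/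
theorem exists_definition (h : IsDefinitional r) (hA : A.Finite) :
    ∃ D : Atom → BForm Atom, (∀ P, r P (P.unravel D)) ∧
      (∀ p q, (D q).Occurs p → D p = atom p) ∧
      ∀ P Q : BForm Atom, P.Over A → Q.Over A → r P Q → P.unravel D = Q.unravel D := by
  -- Letters outside `A` define themselves, so that every formula, not only those over `A`, is
  -- related to its unravelling.
  have : ∀ p : Atom, ∃ N : BForm Atom,
      (p ∈ A → Normal r A N) ∧ (p ∉ A → N = atom p) ∧ r (atom p) N := by
    intro p
    by_cases hp : p ∈ A
    · obtain ⟨N, hN, hr⟩ := h.exists_normal hA ⟨p, hp⟩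
      exact ⟨N, fun _ => hN, fun hn => absurd hp hn, hr⟩
    · exact ⟨atom p, fun hn => absurd hn hp, fun _ => rfl, h.equivalence.refl _⟩
  choose D hD using this
  have hun : ∀ P : BForm Atom, r P (P.unravel D) := fun P => h.rel_unravel fun p _ => (hD p).2.2
  have hnorm : ∀ P : BForm Atom, P.Over A → Normal r A (P.unravel D) := by
    intro P hP s hs
    obtain ⟨q, hq, hsq⟩ := occurs_unravel.1 hs
    exact (hD q).1 (hP q hq) s hsq
  refine ⟨D, hun, ?_, fun P Q hP hQ hr => h.eq_of_normal (hnorm P hP) (hnorm Q hQ) ?_⟩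
  · intro p q hpq
    by_cases hq : q ∈ A
    · have hp := (hD q).1 hq p hpq
      -- A letter of a normal form is itself a normal form, hence equals the normal form `D p` by
      -- uniqueness.
      refine (h.eq_of_normal ?_ ((hD p).1 hp.1) (hD p).2.2).symm
      rintro s rfl
      exact hp
    · have hDq := (hD q).2.1 hq
      rw [hDq] at hpq
      obtain rfl : p = q := hpq
      exact hDq
  · exact h.equivalence.trans (h.equivalence.symm (hun P)) (h.equivalence.trans hr (hun Q))

end IsDefinitional

end BForm

/-! ### Propositional evaluation and the letters of a formula. -/

namespace Formula

variable {Atom : Type u} {Agent : Type v} (e : Formula Atom Agent → Bool)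

theorem propEval_neg (φ : Formula Atom Agent) :
    propEval e (neg φ) = true ↔ ¬ propEval e φ = true := by
  simp [propEval]

theorem propEval_and (φ ψ : Formula Atom Agent) :
    propEval e (and φ ψ) = true ↔ propEval e φ = true ∧ propEval e ψ = true := by
  simp [propEval]

theorem propEval_imp (φ ψ : Formula Atom Agent) :
    propEval e (imp φ ψ) = true ↔ (propEval e φ = true → propEval e ψ = true) := by
  rw [imp, or, propEval_neg, propEval_and, propEval_neg, propEval_neg, propEval_neg]
  tauto

theorem propEval_iff (φ ψ : Formula Atom Agent) :
    propEval e (iff φ ψ) = true ↔ (propEval e φ = true ↔ propEval e ψ = true) := by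
  rw [iff, propEval_and, propEval_imp, propEval_imp]
  tauto

/-- The letters of a formula. -/
def letters : Formula Atom Agent → Set Atom
  | atom p => {p}
  | equiv P Q => {p | P.Occurs p ∨ Q.Occurs p}
  | neg φ => letters φ
  | and φ ψ => letters φ ∪ letters ψ
  | box _ φ => letters φ
  | ann φ ψ => letters φ ∪ letters ψ

theorem _root_.PALD.BForm.finite_occurs (P : BForm Atom) : {p | P.Occurs p}.Finite := by
  induction P with
  | atom q => exact Set.finite_singleton q
  | neg P ih => exact ih
  | and P Q ihP ihQ => exact ihP.union ihQ

theorem finite_letters (φ : Formula Atom Agent) : φ.letters.Finite := by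
  induction φ with
  | atom p => exact Set.finite_singleton p
  | equiv P Q => exact P.finite_occurs.union Q.finite_occurs
  | neg φ ih => exact ih
  | and φ ψ ihφ ihψ => exact ihφ.union ihψ
  | box i φ ih => exact ih
  | ann φ ψ ihφ ihψ => exact ihφ.union ihψ

end Formula

open Formula

variable {Atom : Type u} {Agent : Type v}

theorem Derivable.mono {Sch Sch' : Formula Atom Agent → Prop} (hS : ∀ φ, Sch φ → Sch' φ)
    {φ : Formula Atom Agent} (h : Derivable Sch φ) : Derivable Sch' φ := by
  induction h with
  | scheme φ h => exact .scheme _ (hS _ h)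
  | mp φ ψ _ _ h₁ h₂ => exact .mp _ _ h₁ h₂
  | nec i φ _ h => exact .nec _ _ h

/-! ### Maximal consistent sets -/

section

variable [DecidableEq Atom]

/-- Local derivability from hypotheses: closure under modus ponens of the hypotheses and the
theorems. -/
inductive Entails (Γ : Set (Formula Atom Agent)) : Formula Atom Agent → Prop where
  | thm {φ : Formula Atom Agent} (h : SMLD φ) : Entails Γ φ
  | hyp {φ : Formula Atom Agent} (h : φ ∈ Γ) : Entails Γ φ
  | mp {φ ψ : Formula Atom Agent} (h₁ : Entails Γ φ) (h₂ : Entails Γ (.imp φ ψ)) : Entails Γ ψ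

theorem SMLD.of_tautology {φ : Formula Atom Agent} (h : φ.Tautology) : SMLD φ :=
  .scheme _ (.taut _ h)

namespace Entails

variable {Γ Δ : Set (Formula Atom Agent)} {φ ψ χ : Formula Atom Agent}

theorem of_tautology (h : φ.Tautology) : Entails Γ φ := thm (.of_tautology h)

theorem mono (hΓ : Γ ⊆ Δ) (h : Entails Γ φ) : Entails Δ φ := by
  induction h with
  | thm h => exact thm h
  | hyp h => exact hyp (hΓ h)
  | mp _ _ h₁ h₂ => exact mp h₁ h₂

theorem smld (h : Entails ∅ φ) : SMLD φ := by
  induction h with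
  | thm h => exact h
  | hyp h => exact h.elim
  | mp _ _ h₁ h₂ => exact .mp _ _ h₁ h₂

/-- The usual induction works because necessitation applies only to theorems, never to hypotheses.
-/
theorem deduction (h : Entails (insert φ Γ) ψ) : Entails Γ (.imp φ ψ) := by
  induction h with
  | @thm ψ h =>
    exact mp (thm h) (of_tautology fun e => by simp only [propEval_imp]; tauto)
  | @hyp ψ h =>
    obtain rfl | h := h
    · exact of_tautology fun e => by simp only [propEval_imp]; tauto
    · exact mp (hyp h) (of_tautology fun e => by simp only [propEval_imp]; tauto)
  | @mp ψ χ _ _ h₁ h₂ =>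
    exact mp h₂ (mp h₁ (of_tautology fun e => by simp only [propEval_imp]; tauto))

theorem exists_of_sUnion {c : Set (Set (Formula Atom Agent))} (hc : IsChain (· ⊆ ·) c)
    (hne : c.Nonempty) (h : Entails (⋃₀ c) φ) : ∃ Γ ∈ c, Entails Γ φ := by
  induction h with
  | thm h => exact hne.imp fun Γ hΓ => ⟨hΓ, thm h⟩
  | hyp h =>
    obtain ⟨Γ, hΓ, h⟩ := h
    exact ⟨Γ, hΓ, hyp h⟩
  | mp _ _ h₁ h₂ =>
    obtain ⟨Γ₁, hΓ₁, h₁⟩ := h₁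
    obtain ⟨Γ₂, hΓ₂, h₂⟩ := h₂
    obtain h | h := hc.total hΓ₁ hΓ₂
    · exact ⟨Γ₂, hΓ₂, mp (h₁.mono h) h₂⟩
    · exact ⟨Γ₁, hΓ₁, mp h₁ (h₂.mono h)⟩

theorem box {i : Agent} (h : Entails {χ | Formula.box i χ ∈ Γ} φ) : Entails Γ (.box i φ) := by
  induction h with
  | thm h => exact thm (.nec _ _ h)
  | hyp h => exact hyp h
  | mp _ _ h₁ h₂ => exact mp h₁ (mp h₂ (thm (.scheme _ (.distK _ _ _))))

end Entails

/-- Maximal consistent sets of formulas. -/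
structure IsMCS (Γ : Set (Formula Atom Agent)) : Prop where
  closed : ∀ φ, Entails Γ φ → φ ∈ Γ
  neg_mem_iff : ∀ φ, Formula.neg φ ∈ Γ ↔ φ ∉ Γ

theorem exists_isMCS {Γ : Set (Formula Atom Agent)} {φ : Formula Atom Agent}
    (h : ¬ Entails Γ φ) : ∃ Δ, IsMCS Δ ∧ Γ ⊆ Δ ∧ φ ∉ Δ := by
  -- Zorn is applied to the sets that do not entail `φ`. A maximal one is complete: if it omitted
  -- both `ψ` and its negation, both would imply `φ`, and so `φ` would be entailed.
  obtain ⟨Δ, hΓΔ, hΔ⟩ := zorn_subset_nonempty {Δ | ¬ Entails Δ φ} (fun c hc hch hne =>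
    ⟨⋃₀ c, fun hφ => by
      obtain ⟨Θ, hΘ, hφ⟩ := Entails.exists_of_sUnion hch hne hφ
      exact hc hΘ hφ, fun _ => Set.subset_sUnion_of_mem⟩) Γ h
  have hcl : ∀ ψ, Entails Δ ψ → ψ ∈ Δ := by
    intro ψ hψ
    refine hΔ.2 (y := insert ψ Δ) (fun hφ => hΔ.1 (hψ.mp hφ.deduction)) (Set.subset_insert _ _)
      (Set.mem_insert _ _)
  have hins : ∀ ψ, ψ ∉ Δ → Entails Δ (.imp ψ φ) := by
    intro ψ hψ
    by_contra hφ
    exact hψ (hΔ.2 (y := insert ψ Δ) (fun hn => hφ hn.deduction) (Set.subset_insert _ _)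
      (Set.mem_insert _ _))
  refine ⟨Δ, ⟨hcl, fun ψ => ⟨fun hn hψ => hΔ.1 ?_, fun hψ => ?_⟩⟩, hΓΔ, fun hφ => hΔ.1 (.hyp hφ)⟩
  · exact .mp (.hyp hn) (.mp (.hyp hψ)
      (.of_tautology fun e => by simp only [propEval_imp, propEval_neg]; tauto))
  · by_contra hn
    exact hΔ.1 (.mp (hins _ hn) (.mp (hins _ hψ)
      (.of_tautology fun e => by simp only [propEval_imp, propEval_neg]; tauto)))

namespace IsMCS

variable {Γ : Set (Formula Atom Agent)} {φ ψ : Formula Atom Agent}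

theorem scheme_mem (hΓ : IsMCS Γ) (h : MLDScheme φ) : φ ∈ Γ :=
  hΓ.closed _ (.thm (.scheme _ h))

theorem mp_mem (hΓ : IsMCS Γ) (h : Formula.imp φ ψ ∈ Γ) (hφ : φ ∈ Γ) : ψ ∈ Γ :=
  hΓ.closed _ (.mp (.hyp hφ) (.hyp h))

theorem tautology_mem (hΓ : IsMCS Γ) (h : φ.Tautology) : φ ∈ Γ := hΓ.scheme_mem (.taut _ h)

theorem and_mem_iff (hΓ : IsMCS Γ) : Formula.and φ ψ ∈ Γ ↔ φ ∈ Γ ∧ ψ ∈ Γ := by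
  refine ⟨fun h => ⟨hΓ.mp_mem (hΓ.tautology_mem fun e => ?_) h,
    hΓ.mp_mem (hΓ.tautology_mem fun e => ?_) h⟩,
    fun h => hΓ.mp_mem (hΓ.mp_mem (hΓ.tautology_mem fun e => ?_) h.1) h.2⟩
  all_goals
    simp only [propEval_imp, propEval_and]
    tauto

theorem iff_mem (hΓ : IsMCS Γ) (h : Formula.iff φ ψ ∈ Γ) : φ ∈ Γ ↔ ψ ∈ Γ :=
  ⟨hΓ.mp_mem (hΓ.and_mem_iff.1 h).1, hΓ.mp_mem (hΓ.and_mem_iff.1 h).2⟩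

theorem isDefinitional (hΓ : IsMCS Γ) :
    BForm.IsDefinitional fun P Q => Formula.equiv P Q ∈ Γ where
  equivalence :=
    { refl := fun P => hΓ.scheme_mem (.refl P)
      symm := fun {P Q} => hΓ.mp_mem (hΓ.scheme_mem (.symm P Q))
      trans := fun {P Q R} h h' =>
        hΓ.mp_mem (hΓ.scheme_mem (.trans P Q R)) (hΓ.and_mem_iff.2 ⟨h, h'⟩) }
  neg_iff := fun P Q => hΓ.iff_mem (hΓ.scheme_mem (.patternNeg P Q))
  and_iff := fun P Q R S =>
    (hΓ.iff_mem (hΓ.scheme_mem (.patternAnd P Q R S))).trans hΓ.and_mem_iff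
  mismatch := fun P Q R => (hΓ.neg_mem_iff _).1 (hΓ.scheme_mem (.mismatch P Q R))
  noncircular := fun p P h h' => (hΓ.neg_mem_iff _).1 (hΓ.scheme_mem (.noncircular p P h h'))

open Classical in
/-- The valuation given by a maximal consistent set. -/
noncomputable def valuation (Γ : Set (Formula Atom Agent)) (p : Atom) : Bool :=
  decide (Formula.atom p ∈ Γ)

theorem eval_valuation (hΓ : IsMCS Γ) (P : BForm Atom) :
    P.eval (valuation Γ) = true ↔ P.toFormula ∈ Γ := by
  induction P with
  | atom p => simp [BForm.eval, BForm.toFormula, valuation]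
  | neg P ih => simp [BForm.eval, BForm.toFormula, hΓ.neg_mem_iff, ← ih]
  | and P Q ihP ihQ => simp [BForm.eval, BForm.toFormula, hΓ.and_mem_iff, ← ihP, ← ihQ]

theorem exists_definition (hΓ : IsMCS Γ) {A : Set Atom} (hA : A.Finite) :
    ∃ D : Atom → BForm Atom, (∀ P, Formula.equiv P (P.unravel D) ∈ Γ) ∧
      (∀ p q, (D q).Occurs p → D p = .atom p) ∧
      ∀ P Q : BForm Atom, P.Over A → Q.Over A → Formula.equiv P Q ∈ Γ →
        P.unravel D = Q.unravel D :=
  hΓ.isDefinitional.exists_definition hA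

theorem equiv_mem_of_unravel_eq (hΓ : IsMCS Γ) {D : Atom → BForm Atom}
    (hD : ∀ P, Formula.equiv P (P.unravel D) ∈ Γ) {P Q : BForm Atom}
    (h : P.unravel D = Q.unravel D) : Formula.equiv P Q ∈ Γ :=
  hΓ.isDefinitional.equivalence.trans (hD P)
    (h ▸ hΓ.isDefinitional.equivalence.symm (hD Q))

end IsMCS

/-- The canonical model relative to a finite set of letters. -/
noncomputable def canonicalModel {A : Set Atom} (hA : A.Finite)
    (hne : ∃ Γ : Set (Formula Atom Agent), IsMCS Γ) : Model.{u, v, max u v} Atom Agent where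
  World := {Γ : Set (Formula Atom Agent) // IsMCS Γ}
  nonempty := nonempty_subtype.2 hne
  R := fun i Γ Δ => ∀ φ, Formula.box i φ ∈ Γ.1 → φ ∈ Δ.1
  V := fun Γ => IsMCS.valuation Γ.1
  DEF := fun Γ => (Γ.2.exists_definition hA).choose
  eval_eq := fun Γ P Q h => by
    -- Condition (a) concerns all boolean formulas, not only those over `A`. It holds since each is
    -- related in `Γ` to its unravelling and related formulas are provably equivalent.
    have hPQ := Γ.2.equiv_mem_of_unravel_eq (Γ.2.exists_definition hA).choose_spec.1 h
    have := Γ.2.iff_mem (Γ.2.mp_mem (Γ.2.scheme_mem (.equivalence P Q)) hPQ)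
    rw [Bool.eq_iff_iff, Γ.2.eval_valuation, Γ.2.eval_valuation, this]
  selfEvident := fun Γ => (Γ.2.exists_definition hA).choose_spec.2.1

/-- The truth lemma. The bound on letters matters only for `≡`: membership in `Γ` forces equal
unravellings only over `A`. -/
theorem sat_canonicalModel {A : Set Atom} (hA : A.Finite)
    (hne : ∃ Γ : Set (Formula Atom Agent), IsMCS Γ) (φ : Formula Atom Agent) (hφ : φ.AnnFree)
    (hφA : φ.letters ⊆ A) (Γ : {Γ : Set (Formula Atom Agent) // IsMCS Γ}) :
    Sat φ (canonicalModel hA hne) Γ ↔ φ ∈ Γ.1 := by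
  induction φ generalizing Γ with
  | atom p => simp [Sat, canonicalModel, IsMCS.valuation]
  | equiv P Q =>
    have hD := (Γ.2.exists_definition hA).choose_spec
    exact ⟨Γ.2.equiv_mem_of_unravel_eq hD.1,
      hD.2.2 P Q (fun p hp => hφA (Or.inl hp)) (fun p hp => hφA (Or.inr hp))⟩
  | neg φ ih => exact (not_congr (ih hφ hφA Γ)).trans (Γ.2.neg_mem_iff φ).symm
  | and φ ψ ihφ ihψ =>
    exact (and_congr (ihφ hφ.1 (Set.union_subset_iff.1 hφA).1 Γ)
      (ihψ hφ.2 (Set.union_subset_iff.1 hφA).2 Γ)).trans Γ.2.and_mem_iff.symm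
  | box i φ ih =>
    refine ⟨fun h => ?_, fun h Δ hΔ => (ih hφ hφA Δ).2 (hΔ _ h)⟩
    by_contra hn
    -- If the boxed content of `Γ` entailed `φ`, then `Γ` would entail `□ᵢφ`; so it extends to a
    -- successor that omits `φ`.
    obtain ⟨Δ, hΔ, hsub, hmem⟩ := exists_isMCS fun h' => hn (Γ.2.closed _ (Entails.box h'))
    exact hmem ((ih hφ hφA ⟨Δ, hΔ⟩).1 (h ⟨Δ, hΔ⟩ fun χ hχ => hsub hχ))
  | ann φ ψ => exact hφ.elim

theorem SMLD.of_valid {φ : Formula Atom Agent} (hφ : φ.AnnFree)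
    (h : Valid.{u, v, max u v} φ) : SMLD φ := by
  by_contra hn
  obtain ⟨Γ, hΓ, -, hmem⟩ := exists_isMCS fun h' => hn (Entails.smld h')
  exact hmem ((sat_canonicalModel φ.finite_letters ⟨Γ, hΓ⟩ φ hφ subset_rfl ⟨Γ, hΓ⟩).1 (h _ _))

end

/-! ### Elimination of announcements -/

/-- Truth is invariant under isomorphism of models. -/
theorem sat_congr (φ : Formula Atom Agent) {M N : Model.{u, v, w} Atom Agent}
    (e : M.World ≃ N.World) (hR : ∀ i x y, M.R i x y ↔ N.R i (e x) (e y))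
    (hV : ∀ x, M.V x = N.V (e x)) (hD : ∀ x, M.DEF x = N.DEF (e x)) (x : M.World) :
    Sat φ M x ↔ Sat φ N (e x) := by
  induction φ generalizing M N with
  | atom p => rw [Sat, Sat, hV]
  | equiv P Q => rw [Sat, Sat, hD]
  | neg φ ih => rw [Sat, Sat, ih e hR hV hD]
  | and φ ψ ihφ ihψ => rw [Sat, Sat, ihφ e hR hV hD, ihψ e hR hV hD]
  | box i φ ih =>
    rw [Sat, Sat, ← e.forall_congr_right]
    exact forall_congr' fun y => by rw [hR, ih e hR hV hD]
  | ann φ ψ ihφ ihψ =>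
    rw [Sat, Sat]
    have hφ := ihφ e hR hV hD
    exact forall_prop_congr (fun h => ihψ (M := M.restrict _ ⟨x, h⟩)
      (N := N.restrict _ ⟨e x, (hφ x).1 h⟩) (e.subtypeEquiv hφ)
      (fun i y z => hR i y.1 z.1) (fun y => hV y.1) (fun y => hD y.1) ⟨x, h⟩) (hφ x)

theorem sat_imp {φ ψ : Formula Atom Agent} {M : Model.{u, v, w} Atom Agent} {x : M.World} :
    Sat (.imp φ ψ) M x ↔ (Sat φ M x → Sat ψ M x) := by
  simp only [Formula.imp, Formula.or, Sat]
  tauto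

/-- The worlds surviving two announcements are those where `φ ∧ [φ]ψ` holds. The iterated
restriction is a subtype of a subtype, hence only isomorphic to the single one, which is why
`sat_congr` is needed. -/
theorem sat_ann_ann (φ ψ ξ : Formula Atom Agent) (M : Model.{u, v, w} Atom Agent) (x : M.World) :
    Sat (.ann φ (.ann ψ ξ)) M x ↔ Sat (.ann (.and φ (.ann φ ψ)) ξ) M x := by
  have key (h : Sat φ M x) (h' : Sat ψ (M.restrict {y | Sat φ M y} ⟨x, h⟩) ⟨x, h⟩)
      (h'' : Sat (.and φ (.ann φ ψ)) M x) :
      Sat ξ ((M.restrict {y | Sat φ M y} ⟨x, h⟩).restrict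
        {y | Sat ψ (M.restrict {y | Sat φ M y} ⟨x, h⟩) y} ⟨⟨x, h⟩, h'⟩) ⟨⟨x, h⟩, h'⟩ ↔
      Sat ξ (M.restrict {y | Sat (.and φ (.ann φ ψ)) M y} ⟨x, h''⟩) ⟨x, h''⟩ :=
    sat_congr ξ (M := (M.restrict {y | Sat φ M y} ⟨x, h⟩).restrict
        {y | Sat ψ (M.restrict {y | Sat φ M y} ⟨x, h⟩) y} ⟨⟨x, h⟩, h'⟩)
      (N := M.restrict {y | Sat (.and φ (.ann φ ψ)) M y} ⟨x, h''⟩)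
      { toFun := fun y => ⟨y.1.1, y.1.2, fun _ => y.2⟩
        invFun := fun y => ⟨⟨y.1, y.2.1⟩, y.2.2 y.2.1⟩
        left_inv := fun _ => rfl
        right_inv := fun _ => rfl }
      (fun _ _ _ => Iff.rfl) (fun _ => rfl) (fun _ => rfl) ⟨⟨x, h⟩, h'⟩
  exact ⟨fun H h => (key h.1 (h.2 h.1) h).1 (H h.1 (h.2 h.1)),
    fun H h h' => (key h h' ⟨h, fun _ => h'⟩).2 (H ⟨h, fun _ => h'⟩)⟩

section

variable [DecidableEq Atom]

theorem SPALD.of_tautology {φ : Formula Atom Agent} (h : φ.Tautology) : SPALD φ :=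
  .scheme _ (.inl (.taut _ h))

theorem SPALD.of_reduction {φ : Formula Atom Agent} (h : ReductionScheme φ) : SPALD φ :=
  .scheme _ (.inr h)

theorem SPALD.mp {φ ψ : Formula Atom Agent} (h : SPALD (.imp φ ψ)) (hφ : SPALD φ) : SPALD ψ :=
  Derivable.mp _ _ hφ h

theorem SPALD.box_imp {φ ψ : Formula Atom Agent} (i : Agent) (h : SPALD (.imp φ ψ)) :
    SPALD (.imp (.box i φ) (.box i ψ)) :=
  .mp (.scheme _ (.inl (.distK _ _ _))) (Derivable.nec _ _ h)

/-- Provable and semantic equivalence. -/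
def Interchangeable (φ ψ : Formula Atom Agent) : Prop :=
  SPALD (.iff φ ψ) ∧ ∀ (M : Model.{u, v, w} Atom Agent) (x : M.World), Sat φ M x ↔ Sat ψ M x

namespace Interchangeable

variable {φ φ' ψ ψ' χ : Formula Atom Agent}

theorem refl (φ : Formula Atom Agent) : Interchangeable.{u, v, w} φ φ :=
  ⟨.of_tautology fun e => by simp only [propEval_iff], fun _ _ => Iff.rfl⟩

theorem trans (h : Interchangeable.{u, v, w} φ ψ) (h' : Interchangeable.{u, v, w} ψ χ) :
    Interchangeable.{u, v, w} φ χ :=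
  ⟨.mp (.mp (.of_tautology fun e => by simp only [propEval_imp, propEval_iff]; tauto) h.1) h'.1,
    fun M x => (h.2 M x).trans (h'.2 M x)⟩

theorem neg (h : Interchangeable.{u, v, w} φ ψ) :
    Interchangeable.{u, v, w} (.neg φ) (.neg ψ) :=
  ⟨.mp (.of_tautology fun e => by simp only [propEval_imp, propEval_iff, propEval_neg]; tauto) h.1,
    fun M x => not_congr (h.2 M x)⟩

theorem and (h : Interchangeable.{u, v, w} φ φ') (h' : Interchangeable.{u, v, w} ψ ψ') :
    Interchangeable.{u, v, w} (.and φ ψ) (.and φ' ψ') :=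
  ⟨.mp (.mp (.of_tautology fun e => by
      simp only [propEval_imp, propEval_iff, propEval_and]; tauto) h.1) h'.1,
    fun M x => and_congr (h.2 M x) (h'.2 M x)⟩

theorem imp (h : Interchangeable.{u, v, w} φ φ') (h' : Interchangeable.{u, v, w} ψ ψ') :
    Interchangeable.{u, v, w} (.imp φ ψ) (.imp φ' ψ') :=
  (h.neg.neg.and h'.neg).neg

theorem box (i : Agent) (h : Interchangeable.{u, v, w} φ ψ) :
    Interchangeable.{u, v, w} (.box i φ) (.box i ψ) := by
  refine ⟨.mp (.mp (.of_tautology fun e => ?_) (SPALD.box_imp i (φ := φ) (ψ := ψ)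
      (.mp (.of_tautology fun e => ?_) h.1))) (SPALD.box_imp i (φ := ψ) (ψ := φ)
      (.mp (.of_tautology fun e => ?_) h.1)),
    fun M x => forall_congr' fun y => imp_congr_right fun _ => h.2 M y⟩
  all_goals
    simp only [propEval_imp, propEval_iff]
    tauto

theorem ann_atom (φ : Formula Atom Agent) (p : Atom) :
    Interchangeable.{u, v, w} (.ann φ (.atom p)) (.imp φ (.atom p)) := by
  refine ⟨.of_reduction (.atom _ _), fun M x => ?_⟩
  rw [sat_imp]
  exact Iff.rfl

theorem ann_equiv (φ : Formula Atom Agent) (P Q : BForm Atom) :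
    Interchangeable.{u, v, w} (.ann φ (.equiv P Q)) (.imp φ (.equiv P Q)) := by
  refine ⟨.of_reduction (.equiv _ _ _), fun M x => ?_⟩
  rw [sat_imp]
  exact Iff.rfl

theorem ann_neg (φ ψ : Formula Atom Agent) :
    Interchangeable.{u, v, w} (.ann φ (.neg ψ)) (.imp φ (.neg (.ann φ ψ))) := by
  refine ⟨.of_reduction (.neg _ _), fun M x => ?_⟩
  rw [sat_imp]
  exact ⟨fun H h h' => H h (h' h), fun H h h' => H h fun _ => h'⟩

theorem ann_and (φ ψ θ : Formula Atom Agent) :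
    Interchangeable.{u, v, w} (.ann φ (.and ψ θ)) (.and (.ann φ ψ) (.ann φ θ)) :=
  ⟨.of_reduction (.and _ _ _), fun _ _ => forall_and⟩

theorem ann_box (φ : Formula Atom Agent) (i : Agent) (ψ : Formula Atom Agent) :
    Interchangeable.{u, v, w} (.ann φ (.box i ψ)) (.imp φ (.box i (.imp φ (.ann φ ψ)))) := by
  refine ⟨.of_reduction (.box _ _ _), fun M x => ?_⟩
  rw [sat_imp]
  exact ⟨fun H h y hy => sat_imp.2 fun h' _ => H h ⟨y, h'⟩ hy,
    fun H h y hy => sat_imp.1 (H h y.1 hy) y.2 y.2⟩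

theorem ann_ann (φ ψ ξ : Formula Atom Agent) :
    Interchangeable.{u, v, w} (.ann φ (.ann ψ ξ)) (.ann (.and φ (.ann φ ψ)) ξ) :=
  ⟨.of_reduction (.comp _ _ _), sat_ann_ann φ ψ ξ⟩

end Interchangeable

/-- The formula is interchangeable with one without announcements. -/
def Reducible (φ : Formula Atom Agent) : Prop :=
  ∃ χ : Formula Atom Agent, χ.AnnFree ∧ Interchangeable.{u, v, w} φ χ

namespace Reducible

variable {φ ψ : Formula Atom Agent}

theorem of_interchangeable (h : Interchangeable.{u, v, w} φ ψ) (hψ : Reducible.{u, v, w} ψ) :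
    Reducible.{u, v, w} φ :=
  let ⟨χ, hχ, h'⟩ := hψ
  ⟨χ, hχ, h.trans h'⟩

theorem of_annFree (h : φ.AnnFree) : Reducible.{u, v, w} φ := ⟨φ, h, .refl φ⟩

theorem neg (hφ : Reducible.{u, v, w} φ) : Reducible.{u, v, w} (.neg φ) :=
  let ⟨χ, hχ, h⟩ := hφ
  ⟨.neg χ, hχ, h.neg⟩

theorem and (hφ : Reducible.{u, v, w} φ) (hψ : Reducible.{u, v, w} ψ) :
    Reducible.{u, v, w} (.and φ ψ) :=
  let ⟨χ, hχ, h⟩ := hφ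
  let ⟨χ', hχ', h'⟩ := hψ
  ⟨.and χ χ', ⟨hχ, hχ'⟩, h.and h'⟩

theorem imp (hφ : Reducible.{u, v, w} φ) (hψ : Reducible.{u, v, w} ψ) :
    Reducible.{u, v, w} (.imp φ ψ) :=
  (hφ.neg.neg.and hψ.neg).neg

theorem box (i : Agent) (hφ : Reducible.{u, v, w} φ) : Reducible.{u, v, w} (.box i φ) :=
  let ⟨χ, hχ, h⟩ := hφ
  ⟨.box i χ, hχ, h.box i⟩

/-- Induction on the original `ψ`, for all reducible `φ` at once, so nothing is ever replaced by an
equivalent inside an announcement. For `[φ][ψ]ξ`, the hypothesis for `ψ` makes `φ ∧ [φ]ψ` reducible,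
and the hypothesis for `ξ` is then used with that announcement. -/
theorem ann (hφ : Reducible.{u, v, w} φ) : Reducible.{u, v, w} (.ann φ ψ) := by
  induction ψ generalizing φ with
  | atom p => exact of_interchangeable (.ann_atom φ p) (hφ.imp (of_annFree trivial))
  | equiv P Q => exact of_interchangeable (.ann_equiv φ P Q) (hφ.imp (of_annFree trivial))
  | neg ψ ih => exact of_interchangeable (.ann_neg φ ψ) (hφ.imp (ih hφ).neg)
  | and ψ θ ihψ ihθ => exact of_interchangeable (.ann_and φ ψ θ) ((ihψ hφ).and (ihθ hφ))
  | box i ψ ih => exact of_interchangeable (.ann_box φ i ψ) (hφ.imp ((hφ.imp (ih hφ)).box i))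
  | ann ψ ξ ihψ ihξ => exact of_interchangeable (.ann_ann φ ψ ξ) (ihξ (hφ.and (ihψ hφ)))

end Reducible

theorem reducible (φ : Formula Atom Agent) : Reducible.{u, v, w} φ := by
  induction φ with
  | atom p => exact .of_annFree trivial
  | equiv P Q => exact .of_annFree trivial
  | neg φ ih => exact ih.neg
  | and φ ψ ihφ ihψ => exact ihφ.and ihψ
  | box i φ ih => exact ih.box i
  | ann φ ψ ihφ _ => exact ihφ.ann

theorem SPALD.of_valid {φ : Formula Atom Agent} (h : Valid.{u, v, max u v} φ) : SPALD φ := by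
  obtain ⟨χ, hχ, h'⟩ := reducible.{u, v, max u v} φ
  have hS : SPALD χ :=
    -- The semantic half of the equivalence carries validity to `χ`; the provable half then carries
    -- the derivation back to `φ`.
    Derivable.mono (fun _ => Or.inl) (SMLD.of_valid hχ fun M x => (h'.2 M x).1 (h M x))
  exact .mp (.mp (.of_tautology fun e => by simp only [propEval_imp, propEval_iff]; tauto) h'.1) hS

end

end PALD

theorem mainTheorem2 (Atom : Type u) (Agent : Type v) [Countable Atom] [DecidableEq Atom] :
    (∀ φ : PALD.Formula Atom Agent,
      φ.AnnFree → PALD.Valid.{u, v, max u v} φ → PALD.SMLD φ) ∧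
    (∀ φ : PALD.Formula Atom Agent,
      PALD.Valid.{u, v, max u v} φ → PALD.SPALD φ) := by
  exact ⟨fun φ hφ h => .of_valid hφ h, fun φ h => .of_valid h⟩
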